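/- For a real matrix $M$, let $\mathcal{Q}(M)$ be the set of real matrices $X$ of the same size with the same sign pattern as $M$ (for all $i,j$: $M_{ij}>0\Rightarrow X_{ij}>0$, $M_{ij}<0\Rightarrow X_{ij}<0$, $M_{ij}=0\Rightarrow X_{ij}=0$), and let $\mathcal{Q}_0(M)$ be its closure. A real square matrix is a $P_0$-matrix if all of its principal minors are nonnegative. For $M\in\mathbb{R}^{n\times n}$, the second additive compound $M^{[2]}$ is the matrix, with respect to the basis $\{e_i\wedge e_j : i<j\}$ of $\Lambda^2\mathbb{R}^n$, of the linear map determined by $u\wedge v\mapsto (Mu)\wedge v+u\wedge (Mv)$. The nonreal spectrum of a real square matrix is the set of its eigenvalues in $\mathbb{C}\setminus\mathbb{R}$, and $\mathbb{C}_-=\{z\in\mathbb{C}:\operatorname{Re} z<0\}$. A $(0,1,-1)$ matrix is a matrix with all entries in $\{0,1,-1\}$. (i) Let $A$ be any $3\times m$ $(0,1,-1)$ matrix and let $B\in\mathcal{Q}_0(A^t)$. Then $(AB)^{[2]}$ is a $P_0$-matrix and the nonreal spectrum of $AB$ does not intersect $\mathbb{C}_-$. (ii) Let $A$ be any $m\times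 3$ $(0,1,-1)$ matrix and let $B\in\mathcal{Q}_0(A^t)$. Then the nonreal spectrum of $AB$ does not intersect $\mathbb{C}_-$. -/

import Mathlib

/-- `A` is a `(0, 1, -1)` matrix: each of its entries is `0`, `1` or `-1`. -/
def IsZeroOneNegOne {p q : Type*} (A : Matrix p q ℝ) : Prop :=
  ∀ i j, A i j = 0 ∨ A i j = 1 ∨ A i j = -1

/-- The qualitative class `𝒬(M)`: all real matrices with the same sign pattern as `M`. -/
def qualClass {p q : Type*} (M : Matrix p q ℝ) : Set (Matrix p q ℝ) :=
  {X | ∀ i j, (0 < M i j → 0 < X i j) ∧ (M i j < 0 → X i j < 0) ∧ (M i j = 0 → X i j = 0)}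

/-- `𝒬₀(M)`: the topological closure of the qualitative class of `M`. -/
def qualClosure {p q : Type*} (M : Matrix p q ℝ) : Set (Matrix p q ℝ) :=
  closure (qualClass M)

/-- `M` is a `P₀`-matrix: all principal minors of `M` are nonnegative. -/
def IsP0Matrix {p : Type*} [DecidableEq p] (M : Matrix p p ℝ) : Prop :=
  ∀ α : Finset p, α.Nonempty → 0 ≤ (M.submatrix (fun i : α => i.1) (fun i : α => i.1)).det

/-- The alternating map
`(u₁, …, u_k) ↦ ∑ i, u₁ ∧ ⋯ ∧ (f uᵢ) ∧ ⋯ ∧ u_k` with values in the `k`th exterior power. -/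
noncomputable def wedgeDerivation {V : Type*} [AddCommGroup V] [Module ℝ V]
    (k : ℕ) (f : V →ₗ[ℝ] V) : V [⋀^Fin k]→ₗ[ℝ] (⋀[ℝ]^k V) :=
  { (∑ i : Fin k, (exteriorPower.ιMulti ℝ k (M := V)).toMultilinearMap.compLinearMap
      (Function.update (fun _ => LinearMap.id) i f) : MultilinearMap ℝ (fun _ : Fin k => V) _) with
    map_eq_zero_of_eq' := by
      intro v a b hab hne
      have key : ∀ i : Fin k, (fun j => (Function.update (fun _ => LinearMap.id) i f :
          Fin k → V →ₗ[ℝ] V) j (v j)) = Function.update v i (f (v i)) := by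
        intro i
        funext j
        by_cases h : j = i
        · subst h; simp
        · simp [h]
      simp only [AlternatingMap.coe_multilinearMap, MultilinearMap.toFun_eq_coe,
        sum_apply, MultilinearMap.compLinearMap_apply, key]
      rw [Finset.sum_eq_add a b hne]
      · have hsw : Function.update v b (f (v b)) =
            Function.update v a (f (v a)) ∘ Equiv.swap a b := by
          funext j
          by_cases hj : j = a
          · subst hj; simp [hne, hne.symm, hab]
          · by_cases hj' : j = b
            · subst hj'; simp [hab]
            · simp [Equiv.swap_apply_of_ne_of_ne hj hj', hj, hj']
        rw [hsw, AlternatingMap.map_swap _ _ hne, add_neg_cancel]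
      · intro c _ hc
        refine AlternatingMap.map_eq_zero_of_eq _ _ (i := a) (j := b) ?_ hne
        rw [Function.update_of_ne hc.1.symm, Function.update_of_ne hc.2.symm, hab]
      · intro h; exact absurd (Finset.mem_univ a) h
      · intro h; exact absurd (Finset.mem_univ b) h }

/-- The `k`th additive compound of an endomorphism `f`: the linear endomorphism of the `k`th
exterior power with `u₁ ∧ ⋯ ∧ u_k ↦ ∑ i, u₁ ∧ ⋯ ∧ (f uᵢ) ∧ ⋯ ∧ u_k`. -/
noncomputable def additiveCompoundMap {V : Type*} [AddCommGroup V] [Module ℝ V]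
    (k : ℕ) (f : V →ₗ[ℝ] V) : (⋀[ℝ]^k V) →ₗ[ℝ] (⋀[ℝ]^k V) :=
  exteriorPower.alternatingMapLinearEquiv (wedgeDerivation k f)

/-- The defining property of the additive compound on decomposable elements. -/
theorem additiveCompoundMap_apply_ιMulti {V : Type*} [AddCommGroup V] [Module ℝ V]
    (k : ℕ) (f : V →ₗ[ℝ] V) (u : Fin k → V) :
    additiveCompoundMap k f (exteriorPower.ιMulti ℝ k u) =
      ∑ i : Fin k, exteriorPower.ιMulti ℝ k (Function.update u i (f (u i))) := by
  have key : ∀ i : Fin k, (fun j => (Function.update (fun _ => LinearMap.id) i f :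
      Fin k → V →ₗ[ℝ] V) j (u j)) = Function.update u i (f (u i)) := by
    intro i
    funext j
    by_cases h : j = i
    · subst h; simp
    · simp [h]
  rw [additiveCompoundMap, exteriorPower.alternatingMapLinearEquiv_apply_ιMulti]
  change (∑ i : Fin k, (exteriorPower.ιMulti ℝ k (M := V)).toMultilinearMap.compLinearMap
      (Function.update (fun _ => LinearMap.id) i f) :
        MultilinearMap ℝ (fun _ : Fin k => V) _) u = _
  simp only [sum_apply, MultilinearMap.compLinearMap_apply, key]
  rfl

/-- The `k`th additive compound matrix `M^{[k]}` of a square matrix `M`: the matrix of the `k`th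
additive compound with respect to the basis of the exterior power of `ℝⁿ` formed by the wedge
products `e_{i₁} ∧ ⋯ ∧ e_{i_k}`, `i₁ < ⋯ < i_k`, of standard basis vectors. Its rows and columns
are indexed by the `k`-element subsets of `{1, …, n}`. -/
noncomputable def additiveCompound {n : ℕ} (k : ℕ) (M : Matrix (Fin n) (Fin n) ℝ) :
    Matrix (Set.powersetCard (Fin n) k) (Set.powersetCard (Fin n) k) ℝ :=
  LinearMap.toMatrix ((Pi.basisFun ℝ (Fin n)).exteriorPower k)
    ((Pi.basisFun ℝ (Fin n)).exteriorPower k) (additiveCompoundMap k (Matrix.toLin' M))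

/-- The nonreal spectrum of a real square matrix: its complex eigenvalues that are not real. -/
def nonrealSpectrum {p : Type*} [Fintype p] [DecidableEq p] (M : Matrix p p ℝ) : Set ℂ :=
  {z ∈ spectrum ℂ (M.map Complex.ofReal) | z.im ≠ 0}

/-- The open left half-plane `ℂ₋`. -/
def openLeftHalfPlane : Set ℂ :=
  {z | z.re < 0}

/-! Since `A` has entries 0, 1, -1 and `B` has compatible signs, the `k`th diagonal entry of `AB` is
`∑ j, |B j k|`, which bounds every entry of column `k` (`isColumnDiagonalMax_mul`). For a 3 × 3
matrix this domination alone makes all principal minors of the second additive compound nonnegative,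
so the compound has no negative eigenvalue. A nonreal eigenvalue `z` comes with its conjugate, so `2
* z.re` is an eigenvalue of the compound, whence `0 ≤ z.re`. In (ii) the 3 × 3 matrix is `BA`: it
shares the nonzero eigenvalues of `AB`, and its transpose has the same domination. -/

/-- Membership in `𝒬₀(M)` only allows entries whose product with the entry of `M` is nonnegative,
and forces the zeros of `M`. -/
theorem qualClosure_sign {p q : Type*} {M X : Matrix p q ℝ} (hX : X ∈ qualClosure M) (i : p)
    (j : q) : 0 ≤ M i j * X i j ∧ (M i j = 0 → X i j = 0) := by
  have hcont : Continuous fun Y : Matrix p q ℝ => Y i j := by fun_prop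
  -- The strict sign conditions do not survive limits; this nonstrict consequence does.
  have hclosed : IsClosed {Y : Matrix p q ℝ | 0 ≤ M i j * Y i j ∧ (M i j = 0 → Y i j = 0)} := by
    by_cases h : M i j = 0
    · simpa [h] using isClosed_eq hcont continuous_const
    · simpa [h] using isClosed_le continuous_const (continuous_const.mul hcont)
  refine closure_minimal (fun Y hY => ?_) hclosed hX
  obtain ⟨hpos, hneg, hzero⟩ := hY i j
  refine ⟨?_, hzero⟩
  rcases lt_trichotomy (M i j) 0 with h | h | h
  · exact mul_nonneg_of_nonpos_of_nonpos h.le (hneg h).le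
  · simp [h]
  · exact mul_nonneg h.le (hpos h).le

/-- For a `(0, 1, -1)` matrix `A` and `B ∈ 𝒬₀(Aᵗ)`, the product `A k j * B j k` is `|B j k|`. -/
theorem mul_eq_abs_of_mem_qualClosure {p q : Type*} {A : Matrix p q ℝ} (hA : IsZeroOneNegOne A)
    {B : Matrix q p ℝ} (hB : B ∈ qualClosure A.transpose) (k : p) (j : q) :
    A k j * B j k = |B j k| := by
  obtain ⟨h, h0⟩ := qualClosure_sign hB j k
  rw [Matrix.transpose_apply] at h h0
  rcases hA k j with hz | hz | hz
  · simp [h0 hz]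
  · rw [hz, one_mul] at h ⊢
    exact (abs_of_nonneg h).symm
  · rw [hz, neg_one_mul] at h ⊢
    exact (abs_of_nonpos (by linarith)).symm

theorem IsZeroOneNegOne.abs_le_one {p q : Type*} {A : Matrix p q ℝ} (hA : IsZeroOneNegOne A)
    (i : p) (j : q) : |A i j| ≤ 1 := by
  rcases hA i j with h | h | h <;> simp [h]

/-! ### Column domination by the diagonal -/

/-- Each diagonal entry of `M` dominates the absolute values of the entries in its column. -/
def IsColumnDiagonalMax {p : Type*} (M : Matrix p p ℝ) : Prop :=
  ∀ i k, |M i k| ≤ M k k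

theorem isColumnDiagonalMax_mul {p q : Type*} [Fintype q] {A : Matrix p q ℝ}
    (hA : IsZeroOneNegOne A) {B : Matrix q p ℝ} (hB : B ∈ qualClosure A.transpose) :
    IsColumnDiagonalMax (A * B) := by
  intro i k
  rw [Matrix.mul_apply, Matrix.mul_apply]
  refine (Finset.abs_sum_le_sum_abs _ _).trans (Finset.sum_le_sum fun j _ => ?_)
  rw [mul_eq_abs_of_mem_qualClosure hA hB, abs_mul]
  exact mul_le_of_le_one_left (abs_nonneg _) (hA.abs_le_one i j)

/-- In `B * A` the unsigned factor is indexed by the row, so the diagonal dominates rows; hence the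
transpose. -/
theorem isColumnDiagonalMax_transpose_mul {p q : Type*} [Fintype q] {A : Matrix q p ℝ}
    (hA : IsZeroOneNegOne A) {B : Matrix p q ℝ} (hB : B ∈ qualClosure A.transpose) :
    IsColumnDiagonalMax (B * A).transpose := by
  intro i k
  rw [Matrix.transpose_apply, Matrix.transpose_apply, Matrix.mul_apply, Matrix.mul_apply]
  refine (Finset.abs_sum_le_sum_abs _ _).trans (Finset.sum_le_sum fun j _ => ?_)
  rw [mul_comm (B k j) (A j k), mul_eq_abs_of_mem_qualClosure hA hB, abs_mul]
  exact mul_le_of_le_one_right (abs_nonneg _) (hA.abs_le_one j i)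

namespace IsColumnDiagonalMax

variable {p : Type*} {M : Matrix p p ℝ}

theorem diag_nonneg (h : IsColumnDiagonalMax M) (k : p) : 0 ≤ M k k :=
  (abs_nonneg _).trans (h k k)

theorem abs_mul_le (h : IsColumnDiagonalMax M) (i j k l : p) :
    |M i j * M k l| ≤ M j j * M l l := by
  rw [abs_mul]
  exact mul_le_mul (h i j) (h k l) (abs_nonneg _) (h.diag_nonneg j)

theorem abs_mul_mul_le (h : IsColumnDiagonalMax M) (i j k l r s : p) :
    |M i j * M k l * M r s| ≤ M j j * M l l * M s s := by
  rw [abs_mul]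
  exact mul_le_mul (h.abs_mul_le i j k l) (h r s) (abs_nonneg _)
    (mul_nonneg (h.diag_nonneg j) (h.diag_nonneg l))

end IsColumnDiagonalMax

/-! ### Principal minors of the second compound -/

/-- The second additive compound of a `3 × 3` matrix, with respect to the basis
`e₀ ∧ e₁`, `e₀ ∧ e₂`, `e₁ ∧ e₂`. -/
def secondCompoundFinThree {R : Type*} [CommRing R] (M : Matrix (Fin 3) (Fin 3) R) :
    Matrix (Fin 3) (Fin 3) R :=
  !![M 0 0 + M 1 1, M 1 2, -M 0 2; M 2 1, M 0 0 + M 2 2, M 0 1; -M 2 0, M 1 0, M 1 1 + M 2 2]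

theorem secondCompoundFinThree_diag_nonneg {M : Matrix (Fin 3) (Fin 3) ℝ}
    (h : IsColumnDiagonalMax M) (a : Fin 3) : 0 ≤ secondCompoundFinThree M a a := by
  have h0 := h.diag_nonneg 0
  have h1 := h.diag_nonneg 1
  have h2 := h.diag_nonneg 2
  fin_cases a <;> simp [secondCompoundFinThree] <;> positivity

/-- The product of two diagonal entries expands into nonnegative terms, one of which, some `M i i *
M j j`, bounds the subtracted `M i j * M j i`. -/
theorem secondCompoundFinThree_minor_nonneg {M : Matrix (Fin 3) (Fin 3) ℝ}
    (h : IsColumnDiagonalMax M) {a b : Fin 3} (hab : a ≠ b) :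
    0 ≤ secondCompoundFinThree M a a * secondCompoundFinThree M b b -
      secondCompoundFinThree M a b * secondCompoundFinThree M b a := by
  have h0 := h.diag_nonneg 0
  have h1 := h.diag_nonneg 1
  have h2 := h.diag_nonneg 2
  have h00 := mul_nonneg h0 h0
  have h11 := mul_nonneg h1 h1
  have h22 := mul_nonneg h2 h2
  have h01 := mul_nonneg h0 h1
  have h02 := mul_nonneg h0 h2
  have h12 := mul_nonneg h1 h2
  have k01 := (abs_le.mp (h.abs_mul_le 1 0 0 1)).2
  have k02 := (abs_le.mp (h.abs_mul_le 2 0 0 2)).2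
  have k12 := (abs_le.mp (h.abs_mul_le 2 1 1 2)).2
  fin_cases a <;> fin_cases b <;> first | exact absurd rfl hab | skip
  all_goals simp [secondCompoundFinThree]
  all_goals linarith

/-- With diagonal `a, b, c` of `M`, `(a+b)(a+c)(b+c) = ab(a+b) + ac(a+c) + bc(b+c) + 2abc`. The
first three terms absorb the products with a transposed pair, and `2abc` absorbs the two 3-cycles.
-/
theorem secondCompoundFinThree_det_nonneg {M : Matrix (Fin 3) (Fin 3) ℝ}
    (h : IsColumnDiagonalMax M) : 0 ≤ (secondCompoundFinThree M).det := by
  have h0 := h.diag_nonneg 0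
  have h1 := h.diag_nonneg 1
  have h2 := h.diag_nonneg 2
  have k01 := mul_le_mul_of_nonneg_left (abs_le.mp (h.abs_mul_le 1 0 0 1)).2 (add_nonneg h0 h1)
  have k02 := mul_le_mul_of_nonneg_left (abs_le.mp (h.abs_mul_le 2 0 0 2)).2 (add_nonneg h0 h2)
  have k12 := mul_le_mul_of_nonneg_left (abs_le.mp (h.abs_mul_le 2 1 1 2)).2 (add_nonneg h1 h2)
  have c₁ := abs_le.mp (h.abs_mul_mul_le 1 0 2 1 0 2)
  have c₂ := abs_le.mp (h.abs_mul_mul_le 2 0 0 1 1 2)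
  rw [Matrix.det_fin_three]
  simp [secondCompoundFinThree]
  linarith [c₁.1, c₁.2, c₂.1, c₂.2]

/-- A matrix indexed by a type with three elements is a `P₀`-matrix if its diagonal entries, its
principal `2 × 2` minors and its determinant are nonnegative. -/
theorem isP0Matrix_of_card_eq_three {p : Type*} [Fintype p] [DecidableEq p]
    (hp : Fintype.card p = 3) {M : Matrix p p ℝ} (hdiag : ∀ s, 0 ≤ M s s)
    (hminor : ∀ s t, s ≠ t → 0 ≤ M s s * M t t - M s t * M t s) (hdet : 0 ≤ M.det) :
    IsP0Matrix M := by
  intro α hα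
  have hle : α.card ≤ 3 := hp ▸ Finset.card_le_univ α
  have hpos : 0 < α.card := hα.card_pos
  obtain hcard | hcard | hcard : α.card = 1 ∨ α.card = 2 ∨ α.card = 3 := by omega
  · rw [← Matrix.det_submatrix_equiv_self (α.equivFinOfCardEq hcard).symm, Matrix.det_fin_one]
    exact hdiag _
  · rw [← Matrix.det_submatrix_equiv_self (α.equivFinOfCardEq hcard).symm, Matrix.det_fin_two]
    refine hminor _ _ fun hst => ?_
    have := (α.equivFinOfCardEq hcard).symm.injective (Subtype.ext hst)
    exact absurd this (by decide)
  · have huniv : ∀ s, s ∈ α := by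
      rw [← Finset.eq_univ_iff_forall, ← Finset.card_eq_iff_eq_univ, hcard, hp]
    have := Matrix.det_submatrix_equiv_self (Equiv.subtypeUnivEquiv huniv) M
    exact this.symm ▸ hdet

/-! ### Identification with the exterior-power compound -/

/-- The increasing enumerations of the two-element subsets of `Fin 3`, in lexicographic order. -/
def pairEmb : Fin 3 → (Fin 2 ↪o Fin 3) :=
  ![OrderEmbedding.ofStrictMono ![0, 1] (by decide),
    OrderEmbedding.ofStrictMono ![0, 2] (by decide),
    OrderEmbedding.ofStrictMono ![1, 2] (by decide)]

theorem pairEmb_injective : Function.Injective pairEmb := by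
  intro a b hab
  have h0 := DFunLike.congr_fun hab 0
  have h1 := DFunLike.congr_fun hab 1
  revert h0 h1
  fin_cases a <;> fin_cases b <;> simp [pairEmb]

theorem card_powersetCard_three_two : Fintype.card (Set.powersetCard (Fin 3) 2) = 3 := by
  rw [Fintype.card_eq_nat_card, Set.powersetCard.card]
  simp

/-- The two-element subsets of `Fin 3`, in lexicographic order. -/
noncomputable def pairEquiv : Fin 3 ≃ Set.powersetCard (Fin 3) 2 :=
  Equiv.ofBijective (fun a => Set.powersetCard.ofFinEmbEquiv (pairEmb a))
    ((Fintype.bijective_iff_injective_and_card _).mpr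
      ⟨Set.powersetCard.ofFinEmbEquiv.injective.comp pairEmb_injective,
        by rw [card_powersetCard_three_two, Fintype.card_fin]⟩)

theorem ofFinEmbEquiv_symm_pairEquiv (a : Fin 3) :
    Set.powersetCard.ofFinEmbEquiv.symm (pairEquiv a) = pairEmb a :=
  Set.powersetCard.ofFinEmbEquiv.symm_apply_apply _

/-- The entries of the additive compound are determinants of coordinates of the wedge factors,
summed over the factor to which `M` is applied. -/
theorem additiveCompound_apply {n : ℕ} (k : ℕ) (M : Matrix (Fin n) (Fin n) ℝ)
    (s t : Set.powersetCard (Fin n) k) :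
    additiveCompound k M s t = ∑ i : Fin k, (Matrix.of fun a b =>
      Function.update
        (fun c => (Pi.single (Set.powersetCard.ofFinEmbEquiv.symm t c) 1 : Fin n → ℝ)) i
        (M.col (Set.powersetCard.ofFinEmbEquiv.symm t i)) a
          (Set.powersetCard.ofFinEmbEquiv.symm s b)).det := by
  rw [additiveCompound, LinearMap.toMatrix_apply, exteriorPower.basis_apply,
    exteriorPower.ιMulti_family, additiveCompoundMap_apply_ιMulti, map_sum, Finsupp.finsetSum_apply]
  refine Finset.sum_congr rfl fun i _ => ?_
  rw [exteriorPower.basis_repr_apply, exteriorPower.ιMultiDual_apply_ιMulti]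
  simp [Function.comp_def]

theorem additiveCompound_submatrix_pairEquiv (M : Matrix (Fin 3) (Fin 3) ℝ) :
    (additiveCompound 2 M).submatrix pairEquiv pairEquiv = secondCompoundFinThree M := by
  ext a b
  rw [Matrix.submatrix_apply, additiveCompound_apply, ofFinEmbEquiv_symm_pairEquiv,
    ofFinEmbEquiv_symm_pairEquiv, Fin.sum_univ_two, Matrix.det_fin_two, Matrix.det_fin_two]
  fin_cases a <;> fin_cases b <;>
    simp [secondCompoundFinThree, pairEmb, Function.update_apply]

theorem additiveCompound_pairEquiv (M : Matrix (Fin 3) (Fin 3) ℝ) (a b : Fin 3) :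
    additiveCompound 2 M (pairEquiv a) (pairEquiv b) = secondCompoundFinThree M a b := by
  rw [← additiveCompound_submatrix_pairEquiv, Matrix.submatrix_apply]

theorem isP0Matrix_additiveCompound {M : Matrix (Fin 3) (Fin 3) ℝ} (h : IsColumnDiagonalMax M) :
    IsP0Matrix (additiveCompound 2 M) := by
  refine isP0Matrix_of_card_eq_three card_powersetCard_three_two (fun s => ?_)
    (fun s t hst => ?_) ?_
  · obtain ⟨a, rfl⟩ := pairEquiv.surjective s
    rw [additiveCompound_pairEquiv]
    exact secondCompoundFinThree_diag_nonneg h a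
  · obtain ⟨a, rfl⟩ := pairEquiv.surjective s
    obtain ⟨b, rfl⟩ := pairEquiv.surjective t
    simp only [additiveCompound_pairEquiv]
    exact secondCompoundFinThree_minor_nonneg h fun hab => hst (hab ▸ rfl)
  · rw [← Matrix.det_submatrix_equiv_self pairEquiv, additiveCompound_submatrix_pairEquiv]
    exact secondCompoundFinThree_det_nonneg h

/-! ### Nonreal spectrum -/

/-- If `z` is a nonreal root of the characteristic polynomial of a real `3 × 3` matrix `M`, then
`2 * z.re = z + conj z` is an eigenvalue of the second additive compound of `M`. -/
theorem det_smul_one_sub_secondCompoundFinThree {M : Matrix (Fin 3) (Fin 3) ℝ} {z : ℂ}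
    (hz : (M.map Complex.ofReal).charpoly.IsRoot z) (him : z.im ≠ 0) :
    ((2 * z.re) • (1 : Matrix (Fin 3) (Fin 3) ℝ) - secondCompoundFinThree M).det = 0 := by
  rw [Polynomial.IsRoot, Matrix.eval_charpoly, Matrix.det_fin_three] at hz
  have hre := congrArg Complex.re hz
  have him' := congrArg Complex.im hz
  simp at hre him'
  rw [Matrix.det_fin_three]
  simp [secondCompoundFinThree]
  set x := z.re
  set y := z.im
  -- The imaginary part of the characteristic equation, divided by `y ≠ 0`.
  have hy : 3 * x ^ 2 - y ^ 2 - 2 * (M 0 0 + M 1 1 + M 2 2) * x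
      + (M 0 0 * M 1 1 - M 0 1 * M 1 0 + M 0 0 * M 2 2 - M 0 2 * M 2 0
        + M 1 1 * M 2 2 - M 1 2 * M 2 1) = 0 := by
    refine mul_left_cancel₀ him ?_
    linear_combination him'
  -- The multiplier of `hy` is the one that eliminates `y ^ 2` from the real part.
  linear_combination -hre + (M 0 0 + M 1 1 + M 2 2 - 3 * x) * (-1) * hy

/-- If `t = -2 * z.re` were positive, the vanishing determinant would be `-(t³ + c₁t² + c₂t + c₃)`,
where the `cᵢ` are sums of principal minors of the compound, hence nonnegative: a contradiction. -/
theorem re_nonneg_of_isRoot_charpoly {M : Matrix (Fin 3) (Fin 3) ℝ} (h : IsColumnDiagonalMax M)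
    {z : ℂ} (hz : (M.map Complex.ofReal).charpoly.IsRoot z) (him : z.im ≠ 0) : 0 ≤ z.re := by
  by_contra! hneg
  have hdet := det_smul_one_sub_secondCompoundFinThree hz him
  have d0 := secondCompoundFinThree_diag_nonneg h 0
  have d1 := secondCompoundFinThree_diag_nonneg h 1
  have d2 := secondCompoundFinThree_diag_nonneg h 2
  have m01 := secondCompoundFinThree_minor_nonneg h (a := 0) (b := 1) (by decide)
  have m02 := secondCompoundFinThree_minor_nonneg h (a := 0) (b := 2) (by decide)
  have m12 := secondCompoundFinThree_minor_nonneg h (a := 1) (b := 2) (by decide)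
  have hD := secondCompoundFinThree_det_nonneg h
  rw [Matrix.det_fin_three] at hdet hD
  generalize secondCompoundFinThree M = N at *
  simp at hdet
  obtain ⟨t, ht⟩ : ∃ t, t = -(2 * z.re) := ⟨_, rfl⟩
  have htpos : 0 < t := by linarith
  rw [show 2 * z.re = -t by linarith] at hdet
  have q1 := mul_nonneg (sq_nonneg t) (add_nonneg (add_nonneg d0 d1) d2)
  have q2 := mul_nonneg htpos.le (add_nonneg (add_nonneg m01 m02) m12)
  have q3 := pow_pos htpos 3
  linarith

/-- Transferring nonzero roots suffices because a nonreal `z` is nonzero; this lets `M` and `N`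
differ in size. -/
theorem nonrealSpectrum_inter_eq_empty {p : Type*} [Fintype p] [DecidableEq p]
    {M : Matrix p p ℝ} {N : Matrix (Fin 3) (Fin 3) ℝ} (hN : IsColumnDiagonalMax N)
    (hMN : ∀ z : ℂ, z ≠ 0 → (M.map Complex.ofReal).charpoly.IsRoot z →
      (N.map Complex.ofReal).charpoly.IsRoot z) :
    nonrealSpectrum M ∩ openLeftHalfPlane = ∅ := by
  refine Set.eq_empty_of_forall_notMem ?_
  rintro z ⟨⟨hz, him⟩, hneg⟩
  rw [Matrix.mem_spectrum_iff_isRoot_charpoly] at hz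
  have hz0 : z ≠ 0 := fun h0 => him (by rw [h0, Complex.zero_im])
  exact absurd (re_nonneg_of_isRoot_charpoly hN (hMN z hz0 hz) him) (not_le.mpr hneg)

/-- Nonzero roots of the characteristic polynomial of `AB` are roots of that of `(BA)ᵗ`. -/
theorem isRoot_charpoly_transpose_mul_comm {p q : Type*} [Fintype p] [DecidableEq p] [Fintype q]
    [DecidableEq q] {A : Matrix p q ℝ} {B : Matrix q p ℝ} {z : ℂ} (hz0 : z ≠ 0)
    (hz : ((A * B).map Complex.ofReal).charpoly.IsRoot z) :
    ((B * A).transpose.map Complex.ofReal).charpoly.IsRoot z := by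
  have key := congrArg (Polynomial.eval z)
    (Matrix.charpoly_mul_comm' (A.map Complex.ofReal) (B.map Complex.ofReal))
  have hAB : (A * B).map Complex.ofReal = A.map Complex.ofReal * B.map Complex.ofReal :=
    Matrix.map_mul (f := Complex.ofRealHom)
  have hBA : (B * A).map Complex.ofReal = B.map Complex.ofReal * A.map Complex.ofReal :=
    Matrix.map_mul (f := Complex.ofRealHom)
  rw [Matrix.transpose_map, Matrix.charpoly_transpose, hBA]
  rw [hAB, Polynomial.IsRoot] at hz
  rw [Polynomial.eval_mul, Polynomial.eval_mul, hz, mul_zero, Polynomial.eval_pow,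
    Polynomial.eval_X] at key
  exact (mul_eq_zero.mp key.symm).resolve_left (pow_ne_zero _ hz0)

theorem mainTheorem5 :
    (∀ (m : ℕ) (A : Matrix (Fin 3) (Fin m) ℝ), IsZeroOneNegOne A →
      ∀ B ∈ qualClosure A.transpose,
        IsP0Matrix (additiveCompound 2 (A * B)) ∧
        nonrealSpectrum (A * B) ∩ openLeftHalfPlane = ∅) ∧
    (∀ (m : ℕ) (A : Matrix (Fin m) (Fin 3) ℝ), IsZeroOneNegOne A →
      ∀ B ∈ qualClosure A.transpose,
        nonrealSpectrum (A * B) ∩ openLeftHalfPlane = ∅) := by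
  refine ⟨fun m A hA B hB => ?_, fun m A hA B hB => ?_⟩
  · have h := isColumnDiagonalMax_mul hA hB
    exact ⟨isP0Matrix_additiveCompound h, nonrealSpectrum_inter_eq_empty h fun _ _ hz => hz⟩
  · exact nonrealSpectrum_inter_eq_empty (isColumnDiagonalMax_transpose_mul hA hB)
      fun _ hz0 hz => isRoot_charpoly_transpose_mul_comm hz0 hz
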